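/- Let $M$ be a smooth $n$-dimensional manifold without boundary (Hausdorff, second countable), let $g$ be a smooth Riemannian metric on $M$, and let $\phi:(M,g)\to\mathbb E^m$ be a smooth isometric immersion into Euclidean $m$-space, so that $M$ is an (immersed) submanifold of $\mathbb E^m$ with position vector field $\mathbf x=\phi$. Write $\mathbf x=\mathbf x^T+\mathbf x^N$ for the decomposition of $\mathbf x$ into its components tangent and normal to $M$; $\mathbf x^T$, regarded as a vector field on $M$, is the canonical vector field of $M$. For a normal field $\zeta$ let $A_\zeta$ be the shape operator, i.e. $A_\zeta X$ is the tangential component of $-\widetilde\nabla_X\zeta$, where $\widetilde\nabla$ is the flat connection of $\mathbb E^m$. Let $\mathrm{Ric}$ be the Ricci tensor of $(M,g)$ and let $\beta,\gamma,\delta$ be smooth real functions on $M$. For a smooth vector field $\xi$ on $M$ with dual $1$-form $\xi^\flat=g(\xi,\cdot)$, one says that $(M,g,\xi,\beta,\gamma,\delta)$ is a generalized soliton if $\frac12\mathcal L_\xi g+\beta\,\mathrm{Ric}=\gamma\, g+\delta\,\xi^\flat\otimes\xi^\flat$ on $M$. Then $(M,g,\mathbf x^T,\beta,\gamma,\delta)$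 is a generalized soliton if and only if $$\beta\,\mathrm{Ric}(X,Y)=(\gamma-1)\,g(X,Y)+\delta\, g(\mathbf x^T,X)\,g(\mathbf x^T,Y)-g(A_{\mathbf x^N}X,Y)$$ for all smooth vector fields $X,Y$ on $M$. -/

import Mathlib

open Set Bundle Manifold
open scoped Manifold ContDiff RealInnerProductSpace

noncomputable section

/-- The Euclidean space `𝔼ᵐ`. -/
abbrev EucSp (m : ℕ) : Type := EuclideanSpace ℝ (Fin m)

/-! ### Ricci tensor of a metric in Euclidean coordinates

Here `G` is a field of bilinear forms on (an open subset of) `ℝⁿ`. -/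

section Coordinates

variable {n : ℕ}

/-- The Christoffel symbols of `G` at `y`, as a bilinear operation:
`Γ_y(u, v)` is the vector such that, for every `w`,
`G_y(Γ_y(u, v), w) = ½ ((∂_u G)(v, w) + (∂_v G)(u, w) - (∂_w G)(u, v))`. -/
def christoffel (G : EucSp n → EucSp n →L[ℝ] EucSp n →L[ℝ] ℝ) (y u v : EucSp n) : EucSp n :=
  (G y).inverse ((1 / 2 : ℝ) •
    (fderiv ℝ G y u v + fderiv ℝ G y v u - ((fderiv ℝ G y).flip u).flip v))

/-- The curvature tensor `R(u, v) w = ∇_u ∇_v w - ∇_v ∇_u w` at `y`,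
for constant coordinate fields `u, v, w`. -/
def coordCurvature (G : EucSp n → EucSp n →L[ℝ] EucSp n →L[ℝ] ℝ) (y u v w : EucSp n) :
    EucSp n :=
  fderiv ℝ (fun z => christoffel G z v w) y u - fderiv ℝ (fun z => christoffel G z u w) y v
    + christoffel G y u (christoffel G y v w) - christoffel G y v (christoffel G y u w)

/-- The Ricci tensor `Ric(v, w) = trace (u ↦ R(u, v) w)` at `y`. -/
def coordRicci (G : EucSp n → EucSp n →L[ℝ] EucSp n →L[ℝ] ℝ) (y v w : EucSp n) : ℝ :=
  ∑ i : Fin n, coordCurvature G y (EuclideanSpace.single i 1) v w i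

end Coordinates

section Intrinsic

variable {n : ℕ} {M : Type*} [TopologicalSpace M] [ChartedSpace (EucSp n) M]
  [IsManifold (𝓡 n) ∞ M]

/-- `X` is a smooth vector field on `M`. -/
def IsSmoothVectorField (X : (p : M) → TangentSpace (𝓡 n) p) : Prop :=
  ContMDiff (𝓡 n) (𝓡 n).tangent ∞ (fun p => (⟨p, X p⟩ : TangentBundle (𝓡 n) M))

/-- The expression of the Riemannian metric `g` in the chart `ψ` of `M` at `p`:
`G_y(u, v) = g(d(ψ⁻¹)_y u, d(ψ⁻¹)_y v)`. -/
def metricInChart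
    (g : ContMDiffRiemannianMetric (𝓡 n) ∞ (EucSp n) (fun p : M => TangentSpace (𝓡 n) p))
    (p : M) (y : EucSp n) : EucSp n →L[ℝ] EucSp n →L[ℝ] ℝ :=
  let B : EucSp n →L[ℝ] EucSp n →L[ℝ] ℝ := g.inner ((extChartAt (𝓡 n) p).symm y)
  let A : EucSp n →L[ℝ] EucSp n :=
    mfderiv 𝓘(ℝ, EucSp n) (𝓡 n) (extChartAt (𝓡 n) p).symm y
  B.bilinearComp A A

/-- The Ricci tensor of the Riemannian manifold `(M, g)` at `p`, computed in the chart at `p`. -/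
def ricci
    (g : ContMDiffRiemannianMetric (𝓡 n) ∞ (EucSp n) (fun p : M => TangentSpace (𝓡 n) p))
    (p : M) (v w : TangentSpace (𝓡 n) p) : ℝ :=
  coordRicci (metricInChart g p) (extChartAt (𝓡 n) p p)
    (mfderiv (𝓡 n) 𝓘(ℝ, EucSp n) (extChartAt (𝓡 n) p) p v)
    (mfderiv (𝓡 n) 𝓘(ℝ, EucSp n) (extChartAt (𝓡 n) p) p w)

/-- The Lie derivative of the metric,
`(𝓛_ξ g)(X, Y) = ξ (g(X, Y)) - g([ξ, X], Y) - g(X, [ξ, Y])`, at `p`. -/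
def lieDerivMetric
    (g : ContMDiffRiemannianMetric (𝓡 n) ∞ (EucSp n) (fun p : M => TangentSpace (𝓡 n) p))
    (ξ X Y : (p : M) → TangentSpace (𝓡 n) p) (p : M) : ℝ :=
  mvfderiv (𝓡 n) (fun q => g.inner q (X q) (Y q)) p (ξ p)
    - g.inner p (VectorField.mlieBracket (𝓡 n) ξ X p) (Y p)
    - g.inner p (X p) (VectorField.mlieBracket (𝓡 n) ξ Y p)

/-- `(M, g, ξ, β, γ, δ)` is a generalized soliton:
`½ 𝓛_ξ g + β Ric = γ g + δ η ⊗ η`, where `η = ξ♭ = g(ξ, ·)` is the dual form of the smooth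
vector field `ξ`, and `β, γ, δ` are smooth functions. -/
structure IsGeneralizedSoliton
    (g : ContMDiffRiemannianMetric (𝓡 n) ∞ (EucSp n) (fun p : M => TangentSpace (𝓡 n) p))
    (ξ : (p : M) → TangentSpace (𝓡 n) p) (β γ δ : M → ℝ) : Prop where
  smooth_field : IsSmoothVectorField ξ
  smooth_β : ContMDiff (𝓡 n) 𝓘(ℝ, ℝ) ∞ β
  smooth_γ : ContMDiff (𝓡 n) 𝓘(ℝ, ℝ) ∞ γ
  smooth_δ : ContMDiff (𝓡 n) 𝓘(ℝ, ℝ) ∞ δ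
  equation : ∀ X Y : (p : M) → TangentSpace (𝓡 n) p,
    IsSmoothVectorField X → IsSmoothVectorField Y → ∀ p : M,
      (1 / 2 : ℝ) * lieDerivMetric g ξ X Y p + β p * ricci g p (X p) (Y p)
        = γ p * g.inner p (X p) (Y p)
          + δ p * (g.inner p (ξ p) (X p) * g.inner p (ξ p) (Y p))

end Intrinsic

/-! ### Submanifolds of Euclidean space -/

section Extrinsic

variable {n m : ℕ} {M : Type*} [TopologicalSpace M] [ChartedSpace (EucSp n) M]

/-- `φ : (M, g) → 𝔼ᵐ` is a smooth isometric immersion, `g(v, w) = ⟨dφ v, dφ w⟩`.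
(As `g` is positive definite, `dφ` is then injective at each point.) -/
structure IsIsometricImmersion [IsManifold (𝓡 n) ∞ M]
    (g : ContMDiffRiemannianMetric (𝓡 n) ∞ (EucSp n) (fun p : M => TangentSpace (𝓡 n) p))
    (φ : M → EucSp m) : Prop where
  smooth : ContMDiff (𝓡 n) 𝓘(ℝ, EucSp m) ∞ φ
  isometric : ∀ (p : M) (v w : TangentSpace (𝓡 n) p),
    g.inner p v w = ⟪mvfderiv (𝓡 n) φ p v, mvfderiv (𝓡 n) φ p w⟫

/-- The tangent space `dφ(T_pM)` of the immersed submanifold, as a subspace of `𝔼ᵐ`. -/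
def tangentSubspace (n : ℕ) {m : ℕ} {M : Type*} [TopologicalSpace M]
    [ChartedSpace (EucSp n) M] (φ : M → EucSp m) (p : M) : Submodule ℝ (EucSp m) :=
  LinearMap.range (mvfderiv (𝓡 n) φ p).toLinearMap

/-- The tangential component at `p` of a vector `u` of `𝔼ᵐ`, as an element of `T_pM`: the vector
which `dφ` (injective, for an immersion) sends to the orthogonal projection of `u`
to `dφ(T_pM)`. -/
def tangentialPart (φ : M → EucSp m) (p : M) (u : EucSp m) : TangentSpace (𝓡 n) p :=
  Function.invFun (mvfderiv (𝓡 n) φ p) ((tangentSubspace n φ p).starProjection u)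

/-- The normal component at `p` of a vector `u` of `𝔼ᵐ`. -/
def normalPart (n : ℕ) {m : ℕ} {M : Type*} [TopologicalSpace M] [ChartedSpace (EucSp n) M]
    (φ : M → EucSp m) (p : M) (u : EucSp m) : EucSp m :=
  (tangentSubspace n φ p)ᗮ.starProjection u

/-- The canonical vector field `𝐱ᵀ`: the tangential component of the position vector field. -/
def canonicalField (φ : M → EucSp m) (p : M) : TangentSpace (𝓡 n) p :=
  tangentialPart φ p (φ p)

/-- The normal component `𝐱ᴺ` of the position vector field. -/
def positionNormal (n : ℕ) {m : ℕ} {M : Type*} [TopologicalSpace M]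
    [ChartedSpace (EucSp n) M] (φ : M → EucSp m) (p : M) : EucSp m :=
  normalPart n φ p (φ p)

/-- The shape operator `A_ζ` at `p` in the direction of a normal field `ζ`, from the formula of
Weingarten: `A_ζ v` is the tangential component of `-D_v ζ`, where `D` is the flat connection of
`𝔼ᵐ`. -/
def shapeOperator (φ ζ : M → EucSp m) (p : M) (v : TangentSpace (𝓡 n) p) :
    TangentSpace (𝓡 n) p :=
  tangentialPart φ p (-(mvfderiv (𝓡 n) ζ p v))

end Extrinsic

end

/-! ### Directional derivatives, brackets and charts -/

section Differential

variable {n m : ℕ} {M : Type*} [TopologicalSpace M] [ChartedSpace (EucSp n) M]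

/-! The Ricci term is the same on both sides, so all rests on ½ 𝓛_{𝐱ᵀ} g = g + g(A_{𝐱ᴺ} ·, ·). No
Levi-Civita connection is needed: vector fields are pushed to `𝔼ᵐ` by dφ and differentiated with the
flat D. By the product rule and dφ[V, W] = D_V(dφ W) - D_W(dφ V) (`mvfderiv_mlieBracket`), (𝓛_{𝐱ᵀ}
g)(X, Y) = ⟪D_X(dφ 𝐱ᵀ), dφ Y⟫ + ⟪dφ X, D_Y(dφ 𝐱ᵀ)⟫. Since dφ 𝐱ᵀ = 𝐱 - 𝐱ᴺ and D_X 𝐱 = dφ X, the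
tangential part of D_X(dφ 𝐱ᵀ) is X + A_{𝐱ᴺ} X. The two summands agree because A_{𝐱ᴺ} is
self-adjoint. Being a soliton also requires 𝐱ᵀ to be smooth, which is proved separately. -/

theorem mvfderiv_inner_apply {f h : M → EucSp m} {p : M}
    (hf : MDifferentiableAt (𝓡 n) 𝓘(ℝ, EucSp m) f p)
    (hh : MDifferentiableAt (𝓡 n) 𝓘(ℝ, EucSp m) h p) (v : TangentSpace (𝓡 n) p) :
    mvfderiv (𝓡 n) (fun q => ⟪f q, h q⟫) p v
      = ⟪mvfderiv (𝓡 n) f p v, h p⟫ + ⟪f p, mvfderiv (𝓡 n) h p v⟫ := by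
  have hg : MDifferentiableAt (𝓡 n) 𝓘(ℝ, ℝ) (fun q => ⟪f q, h q⟫) p := by
    have := (differentiable_inner (𝕜 := ℝ) (E := EucSp m)).differentiableAt (x := (f p, h p))
    exact this.comp_mdifferentiableAt (f := fun q => (f q, h q)) (hf.prodMk_space hh)
  rw [hg.mvfderiv, hf.mvfderiv, hh.mvfderiv]
  have h1 : DifferentiableAt ℝ (f ∘ (extChartAt (𝓡 n) p).symm) (extChartAt (𝓡 n) p p) := by
    have := (hf.mdifferentiableWithinAt (s := univ)).differentiableWithinAt_comp_extChartAt_symm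
    rwa [preimage_univ, univ_inter, ModelWithCorners.range_eq_univ,
      differentiableWithinAt_univ] at this
  have h2 : DifferentiableAt ℝ (h ∘ (extChartAt (𝓡 n) p).symm) (extChartAt (𝓡 n) p p) := by
    have := (hh.mdifferentiableWithinAt (s := univ)).differentiableWithinAt_comp_extChartAt_symm
    rwa [preimage_univ, univ_inter, ModelWithCorners.range_eq_univ,
      differentiableWithinAt_univ] at this
  have := fderiv_inner_apply ℝ h1 h2 v
  simp only [writtenInExtChartAt, extChartAt_model_space_eq_id, ModelWithCorners.range_eq_univ,
    fderivWithin_univ, PartialEquiv.refl_coe, Function.id_comp]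
  refine Eq.trans this ?_
  simp only [Function.comp_apply, extChartAt_to_inv]
  rw [add_comm]
  rfl

variable [IsManifold (𝓡 n) ∞ M]

/-- The derivative of a smooth function along a smooth vector field is smooth. -/
theorem IsSmoothVectorField.contMDiff_mvfderiv {Z : (p : M) → TangentSpace (𝓡 n) p}
    (hZ : IsSmoothVectorField Z) {φ : M → EucSp m} (hφ : ContMDiff (𝓡 n) 𝓘(ℝ, EucSp m) ∞ φ) :
    ContMDiff (𝓡 n) 𝓘(ℝ, EucSp m) ∞ (fun q => mvfderiv (𝓡 n) φ q (Z q)) := by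
  have h1 := hφ.contMDiff_tangentMap (m := ∞) (by simp)
  exact (contMDiff_snd_tangentBundle_modelSpace (EucSp m) 𝓘(ℝ, EucSp m)).comp (h1.comp hZ)

/-- Chain rule for h ∘ ψ⁻¹, as dψ⁻¹ is invertible on the chart target. The bracket on `M` is defined
by this pullback. -/
theorem fderiv_comp_extChartAt_symm_mpullback {h : M → EucSp m}
    (hh : MDifferentiable (𝓡 n) 𝓘(ℝ, EucSp m) h) (p : M) {y : EucSp n}
    (hy : y ∈ (extChartAt (𝓡 n) p).target) (w : TangentSpace (𝓡 n) ((extChartAt (𝓡 n) p).symm y)) :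
    fderiv ℝ (h ∘ (extChartAt (𝓡 n) p).symm) y
        ((mfderiv 𝓘(ℝ, EucSp n) (𝓡 n) (extChartAt (𝓡 n) p).symm y).inverse w)
      = mvfderiv (𝓡 n) h ((extChartAt (𝓡 n) p).symm y) w := by
  have hinv := isInvertible_mfderivWithin_extChartAt_symm (I := 𝓡 n) hy
  have hd := mdifferentiableWithinAt_extChartAt_symm (I := 𝓡 n) hy
  rw [ModelWithCorners.range_eq_univ] at hinv hd
  rw [mfderivWithin_univ] at hinv
  rw [mdifferentiableWithinAt_univ] at hd
  rw [← mfderiv_eq_fderiv]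
  have := mfderiv_comp_apply (I := 𝓘(ℝ, EucSp n)) (I' := 𝓡 n) (I'' := 𝓘(ℝ, EucSp m)) y (hh _) hd
    ((mfderiv 𝓘(ℝ, EucSp n) (𝓡 n) (extChartAt (𝓡 n) p).symm y).inverse w)
  refine this.trans ?_
  rw [hinv.self_apply_inverse]
  rfl

/-- Along the bracket of two vector fields, differentiation is the commutator. -/
theorem mvfderiv_mlieBracket {φ : M → EucSp m} (hφ : ContMDiff (𝓡 n) 𝓘(ℝ, EucSp m) ∞ φ)
    {V W : (p : M) → TangentSpace (𝓡 n) p} (hV : IsSmoothVectorField V)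
    (hW : IsSmoothVectorField W) (p : M) :
    mvfderiv (𝓡 n) φ p (VectorField.mlieBracket (𝓡 n) V W p)
      = mvfderiv (𝓡 n) (fun q => mvfderiv (𝓡 n) φ q (W q)) p (V p)
        - mvfderiv (𝓡 n) (fun q => mvfderiv (𝓡 n) φ q (V q)) p (W p) := by
  have huniv : (extChartAt (𝓡 n) p).symm ⁻¹' univ ∩ range (𝓡 n) = univ := by
    rw [preimage_univ, univ_inter, ModelWithCorners.range_eq_univ]
  have key : ∀ u : EucSp n, mvfderiv (𝓡 n) φ p
      ((mfderiv (𝓡 n) 𝓘(ℝ, EucSp n) (extChartAt (𝓡 n) p) p).inverse u)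
        = fderiv ℝ (φ ∘ (extChartAt (𝓡 n) p).symm) (extChartAt (𝓡 n) p p) u := by
    intro u
    -- The tangent space at `p` is read in the chart at `p` itself, so there the chart has identity
    -- differential.
    have h1 : mfderiv (𝓡 n) 𝓘(ℝ, EucSp n) (extChartAt (𝓡 n) p) p
        = ContinuousLinearMap.id ℝ (EucSp n) := by
      rw [(mdifferentiableAt_extChartAt (mem_chart_source _ p)).mfderiv,
        ModelWithCorners.range_eq_univ, fderivWithin_univ]
      refine Eq.trans (Filter.EventuallyEq.fderiv_eq ?_) fderiv_id
      filter_upwards [extChartAt_target_mem_nhds (I := 𝓡 n) p] with y hy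
      exact (extChartAt (𝓡 n) p).right_inv hy
    have h2 := (hφ.mdifferentiable (by simp) p).mvfderiv
    rw [ModelWithCorners.range_eq_univ, fderivWithin_univ] at h2
    rw [h1, h2]
    erw [ContinuousLinearMap.inverse_id]
    rfl
  have hdiff : ∀ {Z : (p : M) → TangentSpace (𝓡 n) p}, IsSmoothVectorField Z →
      DifferentiableAt ℝ (VectorField.mpullbackWithin 𝓘(ℝ, EucSp n) (𝓡 n)
        (extChartAt (𝓡 n) p).symm Z (range (𝓡 n))) (extChartAt (𝓡 n) p p) := by
    intro Z hZ
    have := ((hZ p).mdifferentiableAt (by simp)).mdifferentiableWithinAt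
      (s := univ) |>.differentiableWithinAt_mpullbackWithin_vectorField
    rw [huniv] at this
    exact this.differentiableAt Filter.univ_mem
  have hmem : ∀ᶠ y in nhds (extChartAt (𝓡 n) p p), y ∈ (extChartAt (𝓡 n) p).target :=
    extChartAt_target_mem_nhds (I := 𝓡 n) p
  have hpull : ∀ {Z : (p : M) → TangentSpace (𝓡 n) p} {h : M → EucSp m},
      MDifferentiable (𝓡 n) 𝓘(ℝ, EucSp m) h → ∀ y ∈ (extChartAt (𝓡 n) p).target,
      fderiv ℝ (h ∘ (extChartAt (𝓡 n) p).symm) y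
        (VectorField.mpullbackWithin 𝓘(ℝ, EucSp n) (𝓡 n) (extChartAt (𝓡 n) p).symm Z
          (range (𝓡 n)) y)
        = mvfderiv (𝓡 n) h ((extChartAt (𝓡 n) p).symm y) (Z ((extChartAt (𝓡 n) p).symm y)) := by
    intro Z h hh y hy
    rw [VectorField.mpullbackWithin_apply, ModelWithCorners.range_eq_univ, mfderivWithin_univ]
    exact fderiv_comp_extChartAt_symm_mpullback hh p hy _
  have hsnd : ∀ {Z W : (p : M) → TangentSpace (𝓡 n) p}, IsSmoothVectorField Z →
      fderiv ℝ (fun y => fderiv ℝ (φ ∘ (extChartAt (𝓡 n) p).symm) y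
        (VectorField.mpullbackWithin 𝓘(ℝ, EucSp n) (𝓡 n) (extChartAt (𝓡 n) p).symm Z
          (range (𝓡 n)) y)) (extChartAt (𝓡 n) p p)
        (VectorField.mpullbackWithin 𝓘(ℝ, EucSp n) (𝓡 n) (extChartAt (𝓡 n) p).symm W
          (range (𝓡 n)) (extChartAt (𝓡 n) p p))
        = mvfderiv (𝓡 n) (fun q => mvfderiv (𝓡 n) φ q (Z q)) p (W p) := by
    intro Z W hZ
    have h1 := hpull (Z := W) ((hZ.contMDiff_mvfderiv hφ).mdifferentiable (by simp)) _
      (mem_extChartAt_target p)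
    rw [extChartAt_to_inv] at h1
    rw [← h1]
    congr 1
    apply Filter.EventuallyEq.fderiv_eq
    filter_upwards [hmem] with y hy
    exact hpull (hφ.mdifferentiable (by simp)) y hy
  have hf : ContDiffAt ℝ ∞ (φ ∘ (extChartAt (𝓡 n) p).symm) (extChartAt (𝓡 n) p p) := by
    rw [← contMDiffAt_iff_contDiffAt]
    exact hφ.contMDiffAt.comp _ (((contMDiffOn_extChartAt_symm p) _
      (mem_extChartAt_target p)).contMDiffAt hmem)
  rw [VectorField.mlieBracket, VectorField.mlieBracketWithin_apply, huniv, key,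
    ← hsnd hW, ← hsnd hV]
  -- The flat identity, where symmetry of the second derivative cancels the Hessian terms.
  exact (congrArg (fderiv ℝ (φ ∘ (extChartAt (𝓡 n) p).symm) (extChartAt (𝓡 n) p p))
    (congrFun VectorField.lieBracketWithin_univ _)).trans
    (VectorField.fderiv_apply_lieBracket (n := 2) (hf.of_le (WithTop.coe_le_coe.2 (le_top (a := (2 : ℕ∞))))) (by simp)
      (hdiff hW) (hdiff hV))

end Differential

/-- `D†D` is invertible when `D` is injective. -/
theorem isInvertible_adjoint_comp_self {n m : ℕ} (D : EucSp n →L[ℝ] EucSp m)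
    (hD : Function.Injective D) : (ContinuousLinearMap.adjoint D ∘L D).IsInvertible := by
  have hinj : Function.Injective (ContinuousLinearMap.adjoint D ∘L D).toLinearMap := by
    rw [← LinearMap.ker_eq_bot, LinearMap.ker_eq_bot']
    intro u hu
    have h1 : ⟪ContinuousLinearMap.adjoint D (D u), u⟫ = 0 := by
      have : ContinuousLinearMap.adjoint D (D u) = 0 := hu
      rw [this, inner_zero_left]
    rw [ContinuousLinearMap.adjoint_inner_left, inner_self_eq_zero] at h1
    exact hD (h1.trans (map_zero D).symm)
  exact ⟨(LinearEquiv.ofInjectiveEndo _ hinj).toContinuousLinearEquiv, by ext; rfl⟩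

/-- Passing to the adjoint is smooth. -/
theorem contDiff_adjoint {n m : ℕ} :
    ContDiff ℝ ∞ (fun D : EucSp n →L[ℝ] EucSp m => ContinuousLinearMap.adjoint D) := by
  let L : (EucSp n →L[ℝ] EucSp m) →ₗ[ℝ] (EucSp m →L[ℝ] EucSp n) :=
    { toFun := fun D => ContinuousLinearMap.adjoint D
      map_add' := fun D E => map_add _ D E
      map_smul' := fun c D => by simp }
  exact (LinearMap.toContinuousLinearMap L).contDiff

theorem mvfderiv_tangentialPart {n m : ℕ} {M : Type*} [TopologicalSpace M]
    [ChartedSpace (EucSp n) M] (φ : M → EucSp m) (p : M) (u : EucSp m) :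
    mvfderiv (𝓡 n) φ p (tangentialPart φ p u) = (tangentSubspace n φ p).starProjection u :=
  Function.invFun_eq ((tangentSubspace n φ p).starProjection_apply_mem u)

theorem mvfderiv_canonicalField {n m : ℕ} {M : Type*} [TopologicalSpace M]
    [ChartedSpace (EucSp n) M] (φ : M → EucSp m) (p : M) :
    mvfderiv (𝓡 n) φ p (canonicalField φ p) = φ p - positionNormal n φ p := by
  rw [canonicalField, mvfderiv_tangentialPart, positionNormal, normalPart,
    Submodule.starProjection_orthogonal_val, sub_sub_cancel]

/-! ### The canonical field of an isometric immersion -/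

namespace IsIsometricImmersion

variable {n m : ℕ} {M : Type*} [TopologicalSpace M] [ChartedSpace (EucSp n) M]
  [IsManifold (𝓡 n) ∞ M]
  {g : ContMDiffRiemannianMetric (𝓡 n) ∞ (EucSp n) (fun p : M => TangentSpace (𝓡 n) p)}
  {φ : M → EucSp m}

theorem eq_of_forall_inner_eq
    (g : ContMDiffRiemannianMetric (𝓡 n) ∞ (EucSp n) (fun p : M => TangentSpace (𝓡 n) p))
    {p : M} {v v' : TangentSpace (𝓡 n) p} (h : ∀ w, g.inner p v w = g.inner p v' w) :
    v = v' := by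
  by_contra hne
  have := g.pos p (v - v') (sub_ne_zero.2 hne)
  have h0 : g.inner p (v - v') (v - v') = 0 := by
    rw [map_sub (g.inner p)]
    exact sub_eq_zero.2 (h _)
  exact this.ne' h0

theorem injective (hφ : IsIsometricImmersion g φ) (p : M) :
    Function.Injective (mvfderiv (𝓡 n) φ p) := by
  intro v v' h
  refine eq_of_forall_inner_eq g fun w => ?_
  rw [hφ.isometric, hφ.isometric, h]

theorem inner_tangentialPart (hφ : IsIsometricImmersion g φ) (p : M) (u : EucSp m)
    (w : TangentSpace (𝓡 n) p) :
    g.inner p (tangentialPart φ p u) w = ⟪u, mvfderiv (𝓡 n) φ p w⟫ := by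
  rw [hφ.isometric, mvfderiv_tangentialPart, Submodule.inner_starProjection_left_eq_right]
  congr 1
  exact Submodule.starProjection_eq_self_iff.2 (LinearMap.mem_range_self _ w)

/-- In a local trivialization, with D the matrix of dφ, 𝐱ᵀ has the least-squares coordinates
(D†D)⁻¹D†𝐱, and operator inversion is smooth at invertible operators. -/
theorem isSmoothVectorField_canonicalField (hφ : IsIsometricImmersion g φ) :
    IsSmoothVectorField (canonicalField (n := n) φ) := by
  intro p
  set e := trivializationAt (EucSp n) (TangentSpace (𝓡 n)) p
  have hp : p ∈ e.baseSet := mem_baseSet_trivializationAt _ _ p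
  let D : M → EucSp n →L[ℝ] EucSp m := fun q =>
    (mvfderiv (𝓡 n) φ q).comp (e.symmL ℝ q)
  have hD : ContMDiffAt (𝓡 n) 𝓘(ℝ, EucSp n →L[ℝ] EucSp m) ∞ D p := by
    have h := ContMDiffAt.mfderiv_const (m := ∞) hφ.smooth.contMDiffAt (x₀ := p) (by simp)
    refine h.congr_of_eventuallyEq (Filter.Eventually.of_forall fun q => ?_)
    change _ = ((trivializationAt (EucSp m) (TangentSpace 𝓘(ℝ, EucSp m)) (φ p)).continuousLinearMapAt
      ℝ (φ q)).comp _
    rw [TangentBundle.continuousLinearMapAt_model_space]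
    rfl
  have hinj : ∀ q ∈ e.baseSet, Function.Injective (D q) := fun q hq =>
    (hφ.injective q).comp fun u u' h => by
      rw [← e.continuousLinearMapAt_symmL (R := ℝ) hq u, ← e.continuousLinearMapAt_symmL (R := ℝ) hq u']
      exact congrArg _ h
  let a : M → EucSp n := fun q =>
    (ContinuousLinearMap.adjoint (D q) ∘L D q).inverse (ContinuousLinearMap.adjoint (D q) (φ q))
  have hadj : ContMDiffAt (𝓡 n) 𝓘(ℝ, EucSp m →L[ℝ] EucSp n) ∞
      (fun q => ContinuousLinearMap.adjoint (D q)) p :=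
    contDiff_adjoint.contMDiff.contMDiffAt.comp p hD
  have ha : ContMDiffAt (𝓡 n) 𝓘(ℝ, EucSp n) ∞ a p := by
    have h1 := (isInvertible_adjoint_comp_self (D p) (hinj p hp)).contDiffAt_map_inverse (n := ∞)
    exact (h1.contMDiffAt.comp p (hadj.clm_comp hD)).clm_apply
      (hadj.clm_apply hφ.smooth.contMDiffAt)
  have hae : ∀ q ∈ e.baseSet, canonicalField (n := n) φ q = e.symmL ℝ q (a q) := by
    intro q hq
    refine eq_of_forall_inner_eq g fun w => ?_
    obtain ⟨u, rfl⟩ : ∃ u, e.symmL ℝ q u = w := ⟨_, e.symmL_continuousLinearMapAt hq w⟩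
    rw [canonicalField, hφ.inner_tangentialPart, hφ.isometric]
    -- These are the normal equations D†D a = D†𝐱.
    change ⟪φ q, D q u⟫ = ⟪D q (a q), D q u⟫
    rw [← ContinuousLinearMap.adjoint_inner_left, ← ContinuousLinearMap.adjoint_inner_left]
    congr 1
    exact ((isInvertible_adjoint_comp_self (D q) (hinj q hq)).self_apply_inverse _).symm
  refine (e.contMDiffAt_section_iff hp).2 (ha.congr_of_eventuallyEq ?_)
  filter_upwards [e.open_baseSet.mem_nhds hp] with q hq
  rw [hae q hq, e.symmL_apply hq, e.apply_mk_symm hq]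

/-- The derivative of the tangential part of the position vector, in terms of the shape operator. -/
theorem inner_mvfderiv_mvfderiv_canonicalField (hφ : IsIsometricImmersion g φ) (p : M)
    (v w : TangentSpace (𝓡 n) p) :
    ⟪mvfderiv (𝓡 n) (fun q => mvfderiv (𝓡 n) φ q (canonicalField φ q)) p v,
        mvfderiv (𝓡 n) φ p w⟫
      = g.inner p v w + g.inner p (shapeOperator φ (positionNormal n φ) p v) w := by
  have hs := hφ.isSmoothVectorField_canonicalField.contMDiff_mvfderiv hφ.smooth
  have hN : positionNormal n φ = φ - fun q => mvfderiv (𝓡 n) φ q (canonicalField φ q) := by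
    ext1 q
    rw [Pi.sub_apply, mvfderiv_canonicalField, sub_sub_cancel]
  rw [shapeOperator, hφ.inner_tangentialPart, hφ.isometric, hN,
    mvfderiv_sub (hφ.smooth.mdifferentiable (by simp) p) (hs.mdifferentiable (by simp) p),
    sub_apply, neg_sub, inner_sub_left]
  ring

/-- Symmetry of the covariant derivative of the canonical field. -/
theorem inner_mvfderiv_canonicalField_comm (hφ : IsIsometricImmersion g φ)
    {X Y : (p : M) → TangentSpace (𝓡 n) p} (hX : IsSmoothVectorField X)
    (hY : IsSmoothVectorField Y) (p : M) :
    ⟪mvfderiv (𝓡 n) (fun q => mvfderiv (𝓡 n) φ q (canonicalField φ q)) p (X p),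
        mvfderiv (𝓡 n) φ p (Y p)⟫
      = ⟪mvfderiv (𝓡 n) (fun q => mvfderiv (𝓡 n) φ q (canonicalField φ q)) p (Y p),
        mvfderiv (𝓡 n) φ p (X p)⟫ := by
  have hs := (hφ.isSmoothVectorField_canonicalField.contMDiff_mvfderiv
    hφ.smooth).mdifferentiable (by simp) p
  have hd := hφ.smooth.mdifferentiable (by simp) p
  -- Differentiate ⟪dφ 𝐱ᵀ, dφ Y⟫ = ⟪𝐱, dφ Y⟫ along X. The last term is the second fundamental form
  -- paired with 𝐱ᴺ.
  have key : ∀ {X Y : (p : M) → TangentSpace (𝓡 n) p}, IsSmoothVectorField Y →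
      ⟪mvfderiv (𝓡 n) (fun q => mvfderiv (𝓡 n) φ q (canonicalField φ q)) p (X p),
          mvfderiv (𝓡 n) φ p (Y p)⟫
        = ⟪mvfderiv (𝓡 n) φ p (X p), mvfderiv (𝓡 n) φ p (Y p)⟫
          + ⟪φ p - mvfderiv (𝓡 n) φ p (canonicalField φ p),
            mvfderiv (𝓡 n) (fun q => mvfderiv (𝓡 n) φ q (Y q)) p (X p)⟫ := by
    intro X Y hY
    have hY' := (hY.contMDiff_mvfderiv hφ.smooth).mdifferentiable (by simp) p
    have h1 : (fun q => ⟪mvfderiv (𝓡 n) φ q (canonicalField φ q), mvfderiv (𝓡 n) φ q (Y q)⟫)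
        = fun q => ⟪φ q, mvfderiv (𝓡 n) φ q (Y q)⟫ := by
      ext1 q
      rw [← hφ.isometric, canonicalField, hφ.inner_tangentialPart]
    have h2 := mvfderiv_inner_apply hs hY' (X p)
    rw [h1, mvfderiv_inner_apply hd hY'] at h2
    rw [inner_sub_left]
    linarith
  -- 𝐱ᴺ is orthogonal to the tangent vector dφ[X, Y], so that pairing is symmetric in X and Y.
  have hb : ⟪φ p - mvfderiv (𝓡 n) φ p (canonicalField φ p),
      mvfderiv (𝓡 n) φ p (VectorField.mlieBracket (𝓡 n) X Y p)⟫ = 0 := by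
    rw [inner_sub_left, ← hφ.isometric, canonicalField, hφ.inner_tangentialPart, sub_self]
  rw [mvfderiv_mlieBracket hφ.smooth hX hY, inner_sub_right] at hb
  rw [key hY, key hX, real_inner_comm (mvfderiv (𝓡 n) φ p (X p))]
  linarith

/-- The Lie derivative of the metric along the canonical field. -/
theorem lieDerivMetric_canonicalField (hφ : IsIsometricImmersion g φ)
    {X Y : (p : M) → TangentSpace (𝓡 n) p} (hX : IsSmoothVectorField X)
    (hY : IsSmoothVectorField Y) (p : M) :
    lieDerivMetric g (canonicalField φ) X Y p
      = 2 * (g.inner p (X p) (Y p)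
        + g.inner p (shapeOperator φ (positionNormal n φ) p (X p)) (Y p)) := by
  have hξ := hφ.isSmoothVectorField_canonicalField
  have hg : (fun q => g.inner q (X q) (Y q))
      = fun q => ⟪mvfderiv (𝓡 n) φ q (X q), mvfderiv (𝓡 n) φ q (Y q)⟫ := by
    ext1 q
    rw [hφ.isometric]
  have hcomm := hφ.inner_mvfderiv_canonicalField_comm hX hY p
  rw [lieDerivMetric, hg, mvfderiv_inner_apply
    ((hX.contMDiff_mvfderiv hφ.smooth).mdifferentiable (by simp) p)
    ((hY.contMDiff_mvfderiv hφ.smooth).mdifferentiable (by simp) p),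
    ← hφ.inner_mvfderiv_mvfderiv_canonicalField, hφ.isometric, hφ.isometric,
    mvfderiv_mlieBracket hφ.smooth hξ hX, mvfderiv_mlieBracket hφ.smooth hξ hY,
    inner_sub_left, inner_sub_right,
    real_inner_comm (mvfderiv (𝓡 n) (fun q => mvfderiv (𝓡 n) φ q (canonicalField φ q)) p (Y p))]
  linarith

end IsIsometricImmersion

theorem theoremT {n m : ℕ} {M : Type*} [TopologicalSpace M] [T2Space M]
    [SecondCountableTopology M] [ChartedSpace (EucSp n) M] [IsManifold (𝓡 n) ∞ M]
    (g : Bundle.ContMDiffRiemannianMetric (𝓡 n) ∞ (EucSp n) (fun p : M => TangentSpace (𝓡 n) p))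
    (φ : M → EucSp m) (hφ : IsIsometricImmersion g φ)
    (β γ δ : M → ℝ) (hβ : ContMDiff (𝓡 n) 𝓘(ℝ, ℝ) ∞ β) (hγ : ContMDiff (𝓡 n) 𝓘(ℝ, ℝ) ∞ γ)
    (hδ : ContMDiff (𝓡 n) 𝓘(ℝ, ℝ) ∞ δ) :
    IsGeneralizedSoliton g (canonicalField φ) β γ δ ↔
      ∀ X Y : (p : M) → TangentSpace (𝓡 n) p,
        IsSmoothVectorField X → IsSmoothVectorField Y → ∀ p : M,
          β p * ricci g p (X p) (Y p)
            = (γ p - 1) * g.inner p (X p) (Y p)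
              + δ p * g.inner p (canonicalField φ p) (X p) * g.inner p (canonicalField φ p) (Y p)
              - g.inner p (shapeOperator φ (positionNormal n φ) p (X p)) (Y p) := by

  have heq : ∀ X Y : (p : M) → TangentSpace (𝓡 n) p,
      IsSmoothVectorField X → IsSmoothVectorField Y → ∀ p : M,
      ((1 / 2 : ℝ) * lieDerivMetric g (canonicalField φ) X Y p + β p * ricci g p (X p) (Y p)
        = γ p * g.inner p (X p) (Y p)
          + δ p * (g.inner p (canonicalField φ p) (X p) * g.inner p (canonicalField φ p) (Y p)) ↔
      β p * ricci g p (X p) (Y p)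
        = (γ p - 1) * g.inner p (X p) (Y p)
          + δ p * g.inner p (canonicalField φ p) (X p) * g.inner p (canonicalField φ p) (Y p)
          - g.inner p (shapeOperator φ (positionNormal n φ) p (X p)) (Y p)) := by
    intro X Y hX hY p
    rw [hφ.lieDerivMetric_canonicalField hX hY]
    constructor <;> intro h <;> linear_combination h
  exact ⟨fun h X Y hX hY p => (heq X Y hX hY p).1 (h.equation X Y hX hY p),
    fun h => ⟨hφ.isSmoothVectorField_canonicalField, hβ, hγ, hδ,
      fun X Y hX hY p => (heq X Y hX hY p).2 (h X Y hX hY p)⟩⟩
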